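/- For $n \ge 0$ let $\mathcal S_n$ be the Shi arrangement in $\mathbb R^n$, consisting of the hyperplanes $x_i - x_j = 0$ and $x_i - x_j = 1$ for $1 \le i < j \le n$. Let $\chi_{\mathcal S_n}(q) = \sum_{E} \mu(\mathbb R^n, E)\, q^{\dim E}$ be its characteristic polynomial, where $E$ runs over the non-empty intersections of hyperplanes of $\mathcal S_n$ (including the empty intersection $\mathbb R^n$), ordered by reverse inclusion, and $\mu$ is the Möbius function of this poset. For $r \ge 0$ let $$A_r(x) = \sum_{n=0}^r (r-n)^n \frac{x^n}{n!} \in \mathbb Q[x], \qquad 0^0 = 1.$$ Then the limit $F(x) = \lim_{r\to\infty} A_r(x)/A_{r-1}(x)$ exists in the sense of formal power series (each coefficient is eventually constant), $F(0) = 1$, and in the ring $\mathbb Q[q][[x]]$ $$\sum_{n \ge 0} \chi_{\mathcal S_n}(q) \frac{x^n}{n!} = \left(\lim_{r\to\infty} \frac{A_r(x)}{A_{r-1}(x)}\right)^q,$$ where $F^q = \sum_{k \ge 0} \binom{q}{k} (F-1)^k$. In particular, in the same sense of convergence, $$\sum_{n \ge 0} (-1)^n (n+1)^{n-1} \frac{x^n}{n!}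 = \lim_{r\to\infty} \frac{A_{r-1}(x)}{A_r(x)}.$$ -/

import Mathlib

noncomputable section

namespace ShiArr

open Filter PowerSeries

/-- The affine subspace of `ℝⁿ` with equation `c₁ x₁ + ⋯ + cₙ xₙ = b`. -/
def hyperplane {n : ℕ} (c : Fin n → ℝ) (b : ℝ) : AffineSubspace ℝ (Fin n → ℝ) where
  carrier := {x | ∑ i, c i * x i = b}
  smul_vsub_vadd_mem' := by
    intro t p₁ p₂ p₃ h₁ h₂ h₃
    simp only [Set.mem_ofPred_eq] at h₁ h₂ h₃ ⊢
    simp only [vsub_eq_sub, vadd_eq_add, Pi.add_apply, Pi.smul_apply, Pi.sub_apply, smul_eq_mul]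
    have : ∀ i, c i * (t * (p₁ i - p₂ i) + p₃ i)
        = t * (c i * p₁ i) - t * (c i * p₂ i) + c i * p₃ i := fun i => by ring
    simp only [this, Finset.sum_add_distrib, Finset.sum_sub_distrib, ← Finset.mul_sum, h₁, h₂, h₃]
    ring

/-- A (finite, affine) hyperplane arrangement in `ℝⁿ`. -/
structure Arrangement (n : ℕ) where
  hyperplanes : Set (AffineSubspace ℝ (Fin n → ℝ))
  finite : hyperplanes.Finite
  isHyperplane : ∀ H ∈ hyperplanes, ∃ (c : Fin n → ℝ) (b : ℝ), c ≠ 0 ∧ H = hyperplane c b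

namespace Arrangement

variable {n : ℕ} (𝒜 : Arrangement n)

/-- The non-empty intersections of hyperplanes of the arrangement; the empty family of hyperplanes
has intersection `ℝⁿ`. -/
def intersections : Set (AffineSubspace ℝ (Fin n → ℝ)) :=
  {E | E ≠ ⊥ ∧ ∃ ℬ ⊆ 𝒜.hyperplanes, E = sInf ℬ}

/-- The intersection poset: the non-empty intersections, ordered by reverse inclusion. -/
abbrev IntersectionPoset : Type := (𝒜.intersections)ᵒᵈ

theorem finite_intersections : 𝒜.intersections.Finite := by
  refine (𝒜.finite.finite_subsets.image sInf).subset ?_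
  rintro E ⟨-, ℬ, hℬ, rfl⟩
  exact ⟨ℬ, hℬ, rfl⟩

instance : Fintype 𝒜.intersections := 𝒜.finite_intersections.fintype

instance : Fintype 𝒜.IntersectionPoset := OrderDual.fintype _

open Classical in
instance : LocallyFiniteOrder 𝒜.IntersectionPoset := Fintype.toLocallyFiniteOrder

/-- The minimal element `0̂ = ℝⁿ` of the intersection poset. -/
def zeroHat : 𝒜.IntersectionPoset :=
  OrderDual.toDual ⟨⊤, top_ne_bot, ∅, Set.empty_subset _, sInf_empty.symm⟩

/-- The rank `r(x) = n - dim x` of an element of the intersection poset. -/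
def rank (x : 𝒜.IntersectionPoset) : ℕ :=
  n - Module.finrank ℝ (OrderDual.ofDual x).1.direction

open Classical in
/-- The characteristic polynomial `∑ μ(0̂, x) q ^ (n - r(x))`, summed over the intersection
poset. -/
def charPoly : Polynomial ℤ :=
  ∑ x : 𝒜.IntersectionPoset,
    Polynomial.C (IncidenceAlgebra.mu ℤ 𝒜.zeroHat x) * Polynomial.X ^ (n - 𝒜.rank x)

end Arrangement

/-- The Shi arrangement in `ℝⁿ`: the hyperplanes `x_i - x_j = 0` and `x_i - x_j = 1`, for `i < j`.
-/
def shi (n : ℕ) : Arrangement n where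
  hyperplanes := {H | ∃ i j : Fin n, i < j ∧ ∃ a : ℝ, (a = 0 ∨ a = 1) ∧
    H = hyperplane (Pi.single i 1 - Pi.single j 1) a}
  finite := by
    refine (Set.finite_range fun p : Fin n × Fin n × Fin 2 =>
      hyperplane (Pi.single p.1 1 - Pi.single p.2.1 1) (p.2.2.1 : ℝ)).subset ?_
    rintro H ⟨i, j, -, a, rfl | rfl, rfl⟩
    · exact ⟨(i, j, 0), by simp⟩
    · exact ⟨(i, j, 1), by simp⟩
  isHyperplane := by
    rintro H ⟨i, j, hij, a, -, rfl⟩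
    refine ⟨_, a, fun h => ?_, rfl⟩
    have := congrFun h i
    simp [hij.ne] at this

/-- `F₀, F₁, …` converges to `G` as formal power series: the coefficient of each `xⁿ` in `F_r` is
eventually equal to that in `G`. -/
def IsFormalLimit {R : Type*} [Semiring R] (F : ℕ → R⟦X⟧) (G : R⟦X⟧) : Prop :=
  ∀ n : ℕ, ∀ᶠ r in atTop, coeff n (F r) = coeff n G

/-- The power `F ^ c = ∑ₖ (c choose k) (F - 1)ᵏ` of a formal power series `F` with constant
coefficient `1`, for an arbitrary exponent `c` in the coefficient ring. -/
def cpow {R : Type*} [CommRing R] [BinomialRing R] (F : R⟦X⟧) (c : R) : R⟦X⟧ :=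
  (binomialSeries R c).subst (F - 1)

/-- The polynomial `A_r(x) = ∑_{n=0}^r (r - n)ⁿ xⁿ / n!`, with `0⁰ = 1`. -/
def A (r : ℕ) : ℚ⟦X⟧ :=
  ∑ n ∈ Finset.range (r + 1), C (((r : ℚ) - n) ^ n / (n.factorial : ℚ)) * (X : ℚ⟦X⟧) ^ n

/-- The exponential generating function `∑ χ_{S_n}(q) xⁿ / n!` of the characteristic polynomials of
the Shi arrangements, a power series in `x` over `ℚ[q]`. -/
def shiEGF : (Polynomial ℚ)⟦X⟧ :=
  PowerSeries.mk fun n =>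
    Polynomial.C (1 / (n.factorial : ℚ)) * (shi n).charPoly.map (Int.castRingHom ℚ)

end ShiArr

end

namespace ShiArr

open Finset

/-! Two facts meet: the Shi polynomial is `q (q - n)ⁿ⁻¹` for `n ≥ 1` (`charPoly_shi`), and the
series `P_q = ∑ q (q - n)ⁿ⁻¹ xⁿ / n!` satisfies `P_m = P_1 ^ m` for natural `m`. Each coefficient is
polynomial in `q`, so the exponential generating function is `P_1 ^ q` (`eq_cpow_X_of_eval`).

With `S_q = ∑ (q - n)ⁿ xⁿ / n!`, Abel's identity says `P_1 S_q = S_{q+1}`, and `P_q = S_q + x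
S_{q-1}` then gives `P_1 P_q = P_{q+1}`. As `A_r` agrees with `S_r` through degree `r`, the
quotients `A_{r+1} / A_r` tend to `P_1` and their inverses to `P_{-1}`.

For the Shi polynomial, Möbius inversion reduces its value at `q > n` to counting the points of
`(ℤ/q)ⁿ` off the arrangement (`eval_charPoly_shi`). Such a point seats `n` labelled balls on a cycle
of `q` boxes. Cutting the cycle at an empty box leaves a row, described freely by the number of
empty boxes before each ball, so there are `(q - n)ⁿ` rows. Counting pairs (point, empty box) in two
ways gives `χ(q) (q - n) = q (q - n)ⁿ` (`card_avoids_mul`). -/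

/-! ### Abel's identity and the Abel series -/

/-- Up to sign the two powers combine to `(k - 1)ⁿ⁻¹`, so this is the `n`-th finite difference at
`-1` of a polynomial of degree `n - 1`. At `k = 0` the truncated exponent is harmless because the
base is `1`. -/
theorem sum_choose_mul_pow_mul_pow_eq_zero {n : ℕ} (hn : n ≠ 0) :
    ∑ k ∈ range (n + 1), (n.choose k : ℚ) * (1 - k) ^ (k - 1) * ((k : ℚ) - 1) ^ (n - k) = 0 := by
  have h := congrFun (fwdDiff_iter_pow_eq_zero_of_lt (R := ℚ) (Nat.sub_one_lt hn)) (-1)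
  rw [fwdDiff_iter_eq_sum_shift] at h
  have h2 : ∑ k ∈ range (n + 1), (n.choose k : ℚ) * (1 - k) ^ (k - 1) * ((k : ℚ) - 1) ^ (n - k)
      = (-1) ^ (n + 1) * ∑ k ∈ range (n + 1),
        ((-1 : ℤ) ^ (n - k) * n.choose k) • (-1 + k • (1 : ℚ)) ^ (n - 1) := by
    rw [mul_sum]
    refine sum_congr rfl fun k hk => ?_
    have hk : k ≤ n := by simpa [Nat.lt_succ_iff] using hk
    rcases k with _ | k
    · obtain ⟨m, rfl⟩ := Nat.exists_eq_succ_of_ne_zero hn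
      simp only [Nat.sub_zero, Nat.choose_zero_right, Nat.succ_sub_one, zsmul_eq_mul,
        nsmul_eq_mul]
      push_cast
      ring_nf
      simp [pow_succ]
    · obtain ⟨m, rfl⟩ := Nat.exists_eq_add_of_le hk
      have e1 : k + 1 + m - (k + 1) = m := by lia
      have e2 : k + 1 + m - 1 = k + m := by lia
      have e3 : (1 : ℚ) - ((k + 1 : ℕ) : ℚ) = (-1) * k := by push_cast; ring
      have e4 : ((k + 1 : ℕ) : ℚ) - 1 = k := by push_cast; ring
      have e5 : -1 + ((k + 1 : ℕ) : ℚ) = k := by push_cast; ring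
      rw [e1, e2, e3, e4, zsmul_eq_mul, nsmul_eq_mul, mul_one, e5, Nat.add_sub_cancel, mul_pow,
        pow_add (k : ℚ)]
      have e6 : (-1 : ℚ) ^ (k + 1 + m + 1) * (-1) ^ m = (-1) ^ k := by
        rw [show k + 1 + m + 1 = k + 2 * 1 + m by ring, pow_add _ _ m, mul_assoc, ← mul_pow,
          pow_add, pow_mul]
        simp
      push_cast
      rw [← e6]
      ring
  rw [h2, h]
  simp

open Polynomial in
/-- Abel's binomial identity
`∑ₖ (n choose k) p (p - k)ᵏ⁻¹ (q - (n - k))ⁿ⁻ᵏ = (p + q - n)ⁿ` at `p = 1`. -/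
theorem sum_choose_mul_C_mul_pow (n : ℕ) :
    ∑ k ∈ range (n + 1), C ((n.choose k : ℚ) * (1 - k) ^ (k - 1)) *
      (X - C ((n : ℚ) - k)) ^ (n - k) = (X + C (1 - n : ℚ)) ^ n := by
  induction n with
  | zero => simp
  | succ n ih =>
    rw [← sub_eq_zero]
    set P : ℚ[X] := ∑ k ∈ range (n + 1 + 1), C (((n + 1).choose k : ℚ) * (1 - k) ^ (k - 1)) *
      (X - C (((n + 1 : ℕ) : ℚ) - k)) ^ (n + 1 - k) - (X + C (1 - ((n + 1 : ℕ) : ℚ))) ^ (n + 1)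
      with hP
    -- Differentiation turns the identity for `n + 1` into `n + 1` times the identity for `n`,
    -- shifted by `X ↦ X - 1`.
    have hd : derivative P = 0 := by
      have h := congrArg (fun p : ℚ[X] => (n + 1 : ℚ[X]) * p.comp (X - C 1)) ih
      simp only [Polynomial.sum_comp, mul_comp, pow_comp, sub_comp, add_comp, X_comp, C_comp] at h
      rw [hP, derivative_sub, derivative_sum, sum_range_succ]
      have e : (X + C (1 - ((n + 1 : ℕ) : ℚ)) : ℚ[X]) = X - C 1 + C (1 - (n : ℚ)) := by
        simp; ring
      rw [e, derivative_pow, sub_eq_zero]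
      simp only [derivative_add, derivative_sub, derivative_X, derivative_C, derivative_mul,
        derivative_pow, zero_mul, zero_add, sub_zero, mul_one, add_zero, Nat.sub_self,
        Nat.cast_zero, mul_zero, map_zero, Nat.add_sub_cancel]
      rw [show (C ((n + 1 : ℕ) : ℚ) : ℚ[X]) = n + 1 by simp, ← h, mul_sum]
      refine sum_congr rfl fun k hk => ?_
      have hk : k ≤ n := by simpa [Nat.lt_succ_iff] using hk
      have hc : ((n + 1).choose k : ℚ) * ((n + 1 - k : ℕ) : ℚ) = (n + 1) * (n.choose k : ℚ) := by
        have := Nat.choose_mul_succ_eq n k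
        exact_mod_cast (by linarith : (n + 1).choose k * (n + 1 - k) = (n + 1) * n.choose k)
      have e2 : (X - C (((n + 1 : ℕ) : ℚ) - k) : ℚ[X]) = X - C 1 - C ((n : ℚ) - k) := by
        simp; ring
      have hc' := congrArg (C : ℚ → ℚ[X]) hc
      simp only [C_mul, C_add, C_1] at hc'
      rw [e2, show n + 1 - k - 1 = n - k by lia, C_mul, C_mul]
      calc _ = (C ((n + 1).choose k : ℚ) * C ((n + 1 - k : ℕ) : ℚ)) * C ((1 - k : ℚ) ^ (k - 1)) *
            (X - C 1 - C ((n : ℚ) - k)) ^ (n - k) := by ring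
        _ = _ := by rw [hc']; simp; ring
    -- The constant is fixed at the root `n` of the right-hand side.
    have h0 : P.eval (n : ℚ) = 0 := by
      have := sum_choose_mul_pow_mul_pow_eq_zero (Nat.succ_ne_zero n)
      rw [hP, eval_sub, eval_finsetSum, sub_eq_zero]
      simp only [eval_mul, eval_pow, eval_sub, eval_add, eval_X, eval_C]
      rw [show (n : ℚ) + (1 - ((n + 1 : ℕ) : ℚ)) = 0 by push_cast; ring, zero_pow (by lia), ← this]
      refine sum_congr rfl fun k hk => ?_
      push_cast
      ring
    rw [eq_C_of_derivative_eq_zero hd] at h0 ⊢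
    simpa using h0

/-- The power series `∑ₙ (q - n)ⁿ xⁿ / n!`. -/
noncomputable def abelSeries (q : ℚ) : PowerSeries ℚ :=
  PowerSeries.mk fun n => (q - n) ^ n / n.factorial

/-- The value at `q` of `q (q - n)ⁿ⁻¹`, read as `1` for `n = 0`. -/
def abelValue (q : ℚ) (n : ℕ) : ℚ := if n = 0 then 1 else q * (q - n) ^ (n - 1)

/-- The power series `∑ₙ q (q - n)ⁿ⁻¹ xⁿ / n!`. -/
noncomputable def abelPowSeries (q : ℚ) : PowerSeries ℚ :=
  PowerSeries.mk fun n => abelValue q n / n.factorial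

theorem abelValue_one (n : ℕ) : abelValue 1 n = (1 - n) ^ (n - 1) := by
  rcases n with _ | n <;> simp [abelValue]

theorem abelPowSeries_one_mul_abelSeries (q : ℚ) :
    abelPowSeries 1 * abelSeries q = abelSeries (q + 1) := by
  ext n
  rw [PowerSeries.coeff_mul, Nat.sum_antidiagonal_eq_sum_range_succ_mk]
  simp only [abelSeries, abelPowSeries, PowerSeries.coeff_mk, abelValue_one]
  have h := congrArg (Polynomial.eval q) (sum_choose_mul_C_mul_pow n)
  simp only [Polynomial.eval_finsetSum, Polynomial.eval_mul, Polynomial.eval_pow,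
    Polynomial.eval_sub, Polynomial.eval_add, Polynomial.eval_X, Polynomial.eval_C] at h
  rw [show q + 1 - n = q + (1 - n) by ring, ← h, sum_div]
  refine sum_congr rfl fun k hk => ?_
  have hk : k ≤ n := by simpa [Nat.lt_succ_iff] using hk
  rw [Nat.cast_choose ℚ hk, Nat.cast_sub hk]
  have := Nat.factorial_ne_zero n
  field_simp

/-- Write `q = (q - n) + n` in `q (q - n)ⁿ⁻¹`. This carries the shift rule for `abelSeries` over to
`abelPowSeries`. -/
theorem abelPowSeries_eq_add (q : ℚ) :
    abelPowSeries q = abelSeries q + PowerSeries.X * abelSeries (q - 1) := by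
  ext n
  rcases n with _ | n
  · simp [abelSeries, abelPowSeries, abelValue]
  · rw [map_add, PowerSeries.coeff_succ_X_mul]
    simp only [abelSeries, abelPowSeries, PowerSeries.coeff_mk, abelValue]
    rw [if_neg (Nat.succ_ne_zero n), Nat.factorial_succ, Nat.add_sub_cancel]
    push_cast
    rw [show q - 1 - n = q - (n + 1) by ring]
    field_simp
    ring

theorem abelPowSeries_one_mul (q : ℚ) :
    abelPowSeries 1 * abelPowSeries q = abelPowSeries (q + 1) := by
  rw [abelPowSeries_eq_add q, abelPowSeries_eq_add (q + 1), mul_add, mul_left_comm,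
    abelPowSeries_one_mul_abelSeries, abelPowSeries_one_mul_abelSeries, sub_add_eq_add_sub]

theorem abelPowSeries_zero : abelPowSeries 0 = 1 := by
  ext n
  rcases n with _ | n <;> simp [abelPowSeries, abelValue, PowerSeries.coeff_one]

theorem abelPowSeries_natCast (m : ℕ) : abelPowSeries m = abelPowSeries 1 ^ m := by
  induction m with
  | zero => simp [abelPowSeries_zero]
  | succ m ih => rw [Nat.cast_succ, ← abelPowSeries_one_mul, ih, pow_succ']

theorem abelPowSeries_one_mul_neg_one : abelPowSeries 1 * abelPowSeries (-1) = 1 := by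
  rw [abelPowSeries_one_mul, neg_add_cancel, abelPowSeries_zero]

theorem constantCoeff_abelPowSeries (q : ℚ) :
    PowerSeries.constantCoeff (abelPowSeries q) = 1 := by
  rw [← PowerSeries.coeff_zero_eq_constantCoeff_apply]
  simp [abelPowSeries, abelValue]

/-! ### Limits of the quotients of the `A r` -/

theorem coeff_A (r n : ℕ) :
    PowerSeries.coeff n (A r) = if n ≤ r then ((r : ℚ) - n) ^ n / n.factorial else 0 := by
  simp only [A, map_sum, PowerSeries.coeff_C_mul, PowerSeries.coeff_X_pow]
  simp

theorem coeff_A_eq_coeff_abelSeries {r n : ℕ} (h : n ≤ r) :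
    PowerSeries.coeff n (A r) = PowerSeries.coeff n (abelSeries r) := by
  simp [coeff_A, h, abelSeries]

theorem constantCoeff_A (r : ℕ) : PowerSeries.constantCoeff (A r) = 1 := by
  rw [← PowerSeries.coeff_zero_eq_constantCoeff_apply, coeff_A]
  simp

theorem X_pow_dvd_A_succ_sub (r : ℕ) :
    (PowerSeries.X : PowerSeries ℚ) ^ (r + 1) ∣ A (r + 1) - abelPowSeries 1 * A r := by
  have h (s : ℕ) (hs : r ≤ s) :
      (PowerSeries.X : PowerSeries ℚ) ^ (r + 1) ∣ A s - abelSeries s := by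
    rw [PowerSeries.X_pow_dvd_iff]
    intro m hm
    rw [map_sub, coeff_A_eq_coeff_abelSeries (by lia), sub_self]
  have := dvd_sub (h (r + 1) (by lia)) ((h r le_rfl).mul_left (abelPowSeries 1))
  rwa [mul_sub, abelPowSeries_one_mul_abelSeries, Nat.cast_succ, sub_sub_sub_cancel_right] at this

theorem isFormalLimit_of_X_pow_dvd {F : ℕ → PowerSeries ℚ} {G : PowerSeries ℚ}
    (h : ∀ r, (PowerSeries.X : PowerSeries ℚ) ^ (r + 1) ∣ F r - G) : IsFormalLimit F G := by
  intro n
  filter_upwards [Filter.eventually_ge_atTop n] with r hr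
  have := PowerSeries.X_pow_dvd_iff.1 (h r) n (by lia)
  rwa [map_sub, sub_eq_zero] at this

theorem isFormalLimit_A_div :
    IsFormalLimit (fun r => A (r + 1) * (A r)⁻¹) (abelPowSeries 1) := by
  refine isFormalLimit_of_X_pow_dvd fun r => ?_
  have h : A (r + 1) * (A r)⁻¹ - abelPowSeries 1 =
      (A (r + 1) - abelPowSeries 1 * A r) * (A r)⁻¹ := by
    rw [sub_mul, mul_assoc, PowerSeries.mul_inv_cancel _ (by simp [constantCoeff_A]), mul_one]
  rw [h]
  exact (X_pow_dvd_A_succ_sub r).mul_right _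

theorem isFormalLimit_A_div_succ :
    IsFormalLimit (fun r => A r * (A (r + 1))⁻¹) (abelPowSeries (-1)) := by
  refine isFormalLimit_of_X_pow_dvd fun r => ?_
  have h : A r * (A (r + 1))⁻¹ - abelPowSeries (-1) =
      (A (r + 1) - abelPowSeries 1 * A r) * (-(abelPowSeries (-1) * (A (r + 1))⁻¹)) := by
    have h1 := PowerSeries.mul_inv_cancel (A (r + 1)) (by simp [constantCoeff_A])
    have h2 := abelPowSeries_one_mul_neg_one
    linear_combination abelPowSeries (-1) * h1 - A r * (A (r + 1))⁻¹ * h2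
  rw [h]
  exact (X_pow_dvd_A_succ_sub r).mul_right _

theorem abelPowSeries_neg_one :
    abelPowSeries (-1) = PowerSeries.mk fun n : ℕ =>
      (-1 : ℚ) ^ n * ((n : ℚ) + 1) ^ ((n : ℤ) - 1) / (n.factorial : ℚ) := by
  ext n
  simp only [abelPowSeries, PowerSeries.coeff_mk, abelValue]
  rcases n with _ | n
  · simp
  · rw [if_neg (Nat.succ_ne_zero n), Nat.add_sub_cancel,
      show (((n + 1 : ℕ) : ℤ) - 1) = (n : ℤ) by push_cast; ring, zpow_natCast,
      show (-1 : ℚ) - ((n + 1 : ℕ) : ℚ) = (-1) * (((n + 1 : ℕ) : ℚ) + 1) by ring, mul_pow]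
    ring

/-! ### Powers with polynomial exponent -/

theorem map_cpow {R S : Type*} [CommRing R] [BinomialRing R] [CommRing S] [BinomialRing S]
    (f : R →+* S) {F : PowerSeries R} (hF : PowerSeries.constantCoeff F = 1) (c : R) :
    PowerSeries.map f (cpow F c) = cpow (PowerSeries.map f F) (f c) := by
  have hs : PowerSeries.HasSubst (F - 1) :=
    PowerSeries.HasSubst.of_constantCoeff_zero' (by simp [hF])
  have h := PowerSeries.map_subst (h := f) hs (PowerSeries.binomialSeries R c)
  refine h.trans ?_
  have e1 : PowerSeries.map f (PowerSeries.binomialSeries R c)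
      = PowerSeries.binomialSeries S (f c) := by
    ext n
    simp [Ring.map_choose]
  have e2 : MvPowerSeries.map f (F - 1) = PowerSeries.map f F - 1 := by
    change PowerSeries.map f (F - 1) = _
    rw [map_sub, map_one]
  rw [e1, e2, cpow]

theorem cpow_natCast {R : Type*} [CommRing R] [BinomialRing R] {F : PowerSeries R}
    (hF : PowerSeries.constantCoeff F = 1) (m : ℕ) : cpow F (m : R) = F ^ m := by
  have hs : PowerSeries.HasSubst (F - 1) :=
    PowerSeries.HasSubst.of_constantCoeff_zero' (by simp [hF])
  rw [cpow, PowerSeries.binomialSeries_nat, ← PowerSeries.coe_substAlgHom hs, map_pow, map_add,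
    map_one, PowerSeries.substAlgHom_X hs]
  congr 1
  exact add_sub_cancel _ _

theorem eq_cpow_X_of_eval {G : PowerSeries (Polynomial ℚ)} {F : PowerSeries ℚ}
    (hF : PowerSeries.constantCoeff F = 1)
    (h : ∀ m : ℕ, PowerSeries.map (Polynomial.evalRingHom (m : ℚ)) G = F ^ m) :
    G = cpow (PowerSeries.map (Polynomial.C : ℚ →+* Polynomial ℚ) F) Polynomial.X := by
  ext1 n
  refine Polynomial.eq_of_infinite_eval_eq _ _
    ((Set.infinite_range_of_injective (Nat.cast_injective (R := ℚ))).mono ?_)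
  rintro _ ⟨m, rfl⟩
  have hC : PowerSeries.constantCoeff (PowerSeries.map (Polynomial.C : ℚ →+* Polynomial ℚ) F)
      = 1 := by
    rw [← PowerSeries.coeff_zero_eq_constantCoeff_apply, PowerSeries.coeff_map,
      PowerSeries.coeff_zero_eq_constantCoeff_apply, hF, map_one]
  have h1 : PowerSeries.map (Polynomial.evalRingHom (m : ℚ))
      (PowerSeries.map (Polynomial.C : ℚ →+* Polynomial ℚ) F) = F := by
    ext k
    simp
  have h2 := map_cpow (Polynomial.evalRingHom (m : ℚ)) hC Polynomial.X
  rw [h1, Polynomial.coe_evalRingHom, Polynomial.eval_X, cpow_natCast hF, ← h m] at h2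
  have h3 := congrArg (PowerSeries.coeff n) h2
  simp only [PowerSeries.coeff_map] at h3
  exact h3.symm

theorem shiEGF_eq_cpow (hχ : ∀ n, n ≠ 0 →
      (shi n).charPoly = Polynomial.X * (Polynomial.X - Polynomial.C (n : ℤ)) ^ (n - 1))
    (h0 : (shi 0).charPoly = 1) :
    shiEGF = cpow (PowerSeries.map (Polynomial.C : ℚ →+* Polynomial ℚ) (abelPowSeries 1))
      Polynomial.X := by
  refine eq_cpow_X_of_eval (constantCoeff_abelPowSeries 1) fun m => ?_
  rw [← abelPowSeries_natCast]
  ext n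
  simp only [PowerSeries.coeff_map, shiEGF, abelPowSeries, PowerSeries.coeff_mk, abelValue]
  split_ifs with hn
  · subst hn
    simp [h0]
  · rw [hχ n hn]
    simp
    ring

/-! ### Counting placements in a row -/

/-- The rank of the pair `(f i, i)` among all the pairs `(f j, j)`, ordered lexicographically. -/
def lexRank {n : ℕ} (f : Fin n → ℕ) (i : Fin n) : ℕ :=
  #{j | f j < f i ∨ f j = f i ∧ j < i}

/-- The placement of `n` labelled balls in a row of boxes in which `f i` empty boxes precede the
ball `i`, and the labels increase in each run of consecutive balls. -/
def placement {n : ℕ} (f : Fin n → ℕ) (i : Fin n) : ℕ := 1 + f i + lexRank f i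

/-- A placement of `n` labelled balls in the boxes `1, …, q - 1`, at most one in each box, such that
the labels increase in each run of consecutive balls. -/
def IsPlacement {n : ℕ} (q : ℕ) (y : Fin n → ℕ) : Prop :=
  (∀ i, 1 ≤ y i ∧ y i < q) ∧ ∀ i j, i < j → y i ≠ y j ∧ y i ≠ y j + 1

theorem lexRank_lt_lexRank {n : ℕ} {f : Fin n → ℕ} {i j : Fin n}
    (h : f j < f i ∨ f j = f i ∧ j < i) : lexRank f j < lexRank f i := by
  refine card_lt_card ?_
  rw [ssubset_iff_of_subset]
  · refine ⟨j, by simpa using h, by simp⟩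
  · intro k
    simp only [mem_filter, mem_univ, true_and]
    lia

theorem placement_lt_placement {n : ℕ} {f : Fin n → ℕ} {i j : Fin n} :
    placement f j < placement f i ↔ f j < f i ∨ f j = f i ∧ j < i := by
  have key {i j : Fin n} (h : f j < f i ∨ f j = f i ∧ j < i) : placement f j < placement f i := by
    have := lexRank_lt_lexRank h
    unfold placement
    lia
  refine ⟨fun h => ?_, key⟩
  by_contra hc
  rcases eq_or_ne i j with rfl | hij
  · exact lt_irrefl _ h
  · have := key (i := j) (j := i) (by lia)
    lia

theorem lexRank_lt {n : ℕ} (f : Fin n → ℕ) (i : Fin n) : lexRank f i < n := by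
  have : lexRank f i < #(univ : Finset (Fin n)) :=
    card_lt_card (ssubset_univ_iff.2 fun h => by simpa using eq_univ_iff_forall.1 h i)
  simpa using this

theorem isPlacement_placement {n m : ℕ} {f : Fin n → ℕ} (hf : ∀ i, f i < m) :
    IsPlacement (n + m) (placement f) := by
  refine ⟨fun i => ⟨by unfold placement; lia, ?_⟩, fun i j hij => ⟨fun h => ?_, fun h => ?_⟩⟩
  · have := lexRank_lt f i
    have := hf i
    unfold placement
    lia
  · have h1 := (placement_lt_placement (f := f) (i := i) (j := j)).not.1 (by lia)
    have h2 := (placement_lt_placement (f := f) (i := j) (j := i)).not.1 (by lia)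
    lia
  · have h1 := (placement_lt_placement (f := f) (i := i) (j := j)).1 (by lia)
    have h2 := lexRank_lt_lexRank h1
    unfold placement at h
    lia

theorem placement_eq_add_card {n : ℕ} (f : Fin n → ℕ) (i : Fin n) :
    placement f i = 1 + f i + #{j | placement f j < placement f i} := by
  simp only [placement_lt_placement]
  rfl

/-- The balls before ball `i` can be read off the placement, and what remains of its position is `1
+ f i`. -/
theorem placement_injective {n : ℕ} : Function.Injective (placement (n := n)) := by
  intro f g h
  ext i
  have h1 := placement_eq_add_card f i
  have h2 := placement_eq_add_card g i
  rw [h] at h1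
  lia

theorem IsPlacement.injective {n q : ℕ} {y : Fin n → ℕ} (hy : IsPlacement q y) :
    Function.Injective y := by
  intro i j h
  rcases lt_trichotomy i j with hij | hij | hij
  · exact absurd h (hy.2 i j hij).1
  · exact hij
  · exact absurd h.symm (hy.2 j i hij).1

theorem IsPlacement.lt_of_Ico_subset {n q : ℕ} {y : Fin n → ℕ} (hy : IsPlacement q y)
    {i j : Fin n} (hij : y j < y i) (h : ∀ p, y j ≤ p → p < y i → ∃ k, y k = p) : j < i := by
  have key (p : ℕ) (h1 : y j ≤ p) (h2 : p ≤ y i) : ∃ k, y k = p ∧ j ≤ k := by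
    induction p, h1 using Nat.le_induction with
    | base => exact ⟨j, rfl, le_rfl⟩
    | succ p hp ih =>
      obtain ⟨k, hk, hjk⟩ := ih (by lia)
      obtain ⟨l, hl⟩ : ∃ l, y l = p + 1 := by
        rcases eq_or_lt_of_le h2 with h2 | h2
        · exact ⟨i, h2.symm⟩
        · exact h _ (by lia) h2
      refine ⟨l, hl, hjk.trans (le_of_not_gt fun hlk => (hy.2 l k hlk).2 (by lia))⟩
  obtain ⟨k, hk, hjk⟩ := key (y i) hij.le le_rfl
  rw [hy.injective hk] at hjk
  exact lt_of_le_of_ne hjk (by rintro rfl; exact lt_irrefl _ hij)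

theorem IsPlacement.exists_placement_eq {n m : ℕ} {y : Fin n → ℕ} (hm : m ≠ 0)
    (hy : IsPlacement (n + m) y) : ∃ f : Fin n → ℕ, (∀ i, f i < m) ∧ placement f = y := by
  -- The number of empty boxes before ball `i`. If two balls tie, every box between them is full, so
  -- their labels increase; hence lexicographic order is order of position.
  set f : Fin n → ℕ := fun i => #(Ico 1 (y i) \ univ.image y) with hf
  have hle (i j : Fin n) (h : y j ≤ y i) :
      Ico 1 (y j) \ univ.image y ⊆ Ico 1 (y i) \ univ.image y :=
    sdiff_subset_sdiff (Ico_subset_Ico_right h) le_rfl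
  have hlex (i j : Fin n) (h : y j < y i) : f j < f i ∨ f j = f i ∧ j < i := by
    rcases (card_le_card (hle i j h.le)).lt_or_eq with h1 | h1
    · exact Or.inl h1
    · refine Or.inr ⟨h1, hy.lt_of_Ico_subset h fun p hp1 hp2 => ?_⟩
      have h2 := eq_of_subset_of_card_le (hle i j h.le) h1.ge
      by_contra hc
      have h3 : p ∈ Ico 1 (y i) \ univ.image y := by
        simp only [mem_sdiff, mem_Ico, mem_image, mem_univ, true_and]
        exact ⟨⟨(hy.1 j).1.trans hp1, hp2⟩, hc⟩
      rw [← h2] at h3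
      simp only [mem_sdiff, mem_Ico] at h3
      lia
  have hiff (i j : Fin n) : (f j < f i ∨ f j = f i ∧ j < i) ↔ y j < y i := by
    refine ⟨fun h => ?_, hlex i j⟩
    by_contra hc
    rcases eq_or_ne i j with rfl | hij
    · lia
    · have := hy.injective.ne hij
      have := hlex j i (by lia)
      lia
  refine ⟨f, fun i => ?_, funext fun i => ?_⟩
  · have h1 : f i ≤ #(Ico 1 (n + m) \ univ.image y) :=
      card_le_card (sdiff_subset_sdiff (Ico_subset_Ico_right (hy.1 i).2.le) le_rfl)
    have h2 : univ.image y ⊆ Ico 1 (n + m) := by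
      intro p hp
      obtain ⟨k, -, rfl⟩ := mem_image.1 hp
      exact mem_Ico.2 (hy.1 k)
    rw [card_sdiff_of_subset h2, card_image_of_injective _ hy.injective, Nat.card_Ico, card_univ,
      Fintype.card_fin] at h1
    lia
  · have h1 : lexRank f i = #(Ico 1 (y i) ∩ univ.image y) := by
      unfold lexRank
      simp only [hiff]
      rw [← card_image_of_injective _ hy.injective]
      congr 1
      ext p
      simp only [mem_image, mem_filter, mem_univ, true_and, mem_inter, mem_Ico]
      constructor
      · rintro ⟨k, hk, rfl⟩
        exact ⟨⟨(hy.1 k).1, hk⟩, k, rfl⟩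
      · rintro ⟨⟨-, h⟩, k, rfl⟩
        exact ⟨k, h, rfl⟩
    have h2 := card_sdiff_add_card_inter (Ico 1 (y i)) (univ.image y)
    rw [Nat.card_Ico, ← h1] at h2
    have h3 : f i + lexRank f i = y i - 1 := h2
    have := (hy.1 i).1
    unfold placement
    lia

theorem natCard_isPlacement {n m : ℕ} (hm : m ≠ 0) :
    Nat.card {y : Fin n → ℕ // IsPlacement (n + m) y} = m ^ n := by
  have e : Function.Bijective fun f : Fin n → Fin m =>
      (⟨placement fun i => (f i : ℕ), isPlacement_placement fun i => (f i).2⟩ :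
        {y : Fin n → ℕ // IsPlacement (n + m) y}) := by
    constructor
    · intro f g h
      have := placement_injective (Subtype.ext_iff.1 h)
      exact funext fun i => Fin.ext (congrFun this i)
    · rintro ⟨y, hy⟩
      obtain ⟨f, hf, rfl⟩ := hy.exists_placement_eq hm
      exact ⟨fun i => ⟨f i, hf i⟩, rfl⟩
  rw [← Nat.card_eq_of_bijective _ e]
  simp

/-! ### Counting on the cycle `ℤ/q` -/

/-- The point `x` of `(ℤ/q)ⁿ` lies on none of the hyperplanes `x_i - x_j = 0` and
`x_i - x_j = 1`, for `i < j`. -/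
def Avoids {n q : ℕ} (x : Fin n → ZMod q) : Prop :=
  ∀ i j, i < j → x i ≠ x j ∧ x i ≠ x j + 1

theorem Avoids.injective {n q : ℕ} {x : Fin n → ZMod q} (hx : Avoids x) :
    Function.Injective x := by
  intro i j h
  rcases lt_trichotomy i j with hij | hij | hij
  · exact absurd h (hx i j hij).1
  · exact hij
  · exact absurd h.symm (hx j i hij).1

/-- Excluding `a = 0` excludes the wrap-around from `q - 1` to `0`. -/
theorem eq_add_one_iff_val {q : ℕ} [NeZero q] {a b : ZMod q} (ha : a ≠ 0) :
    a = b + 1 ↔ a.val = b.val + 1 := by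
  constructor
  · rintro rfl
    rcases lt_or_eq_of_le (Nat.succ_le_of_lt b.val_lt) with h | h
    · rw [ZMod.val_add_of_lt] <;>
      · rcases eq_or_ne q 1 with rfl | hq
        · exact absurd (Subsingleton.elim _ _) ha
        · rw [ZMod.val_one'' hq]
          try exact h
    · refine absurd ?_ ha
      have : ((b.val + 1 : ℕ) : ZMod q) = 0 := by
        rw [show b.val + 1 = q from h]
        simp
      simpa using this
  · intro h
    have := congrArg (Nat.cast : ℕ → ZMod q) h
    simpa using this

theorem isPlacement_val_iff {n q : ℕ} [NeZero q] {x : Fin n → ZMod q} :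
    IsPlacement q (fun i => (x i).val) ↔ Avoids x ∧ ∀ i, x i ≠ 0 := by
  have h1 (i : Fin n) : 1 ≤ (x i).val ↔ x i ≠ 0 := by
    rw [Nat.one_le_iff_ne_zero, Ne, ZMod.val_eq_zero]
  simp only [IsPlacement, Avoids, h1, ZMod.val_lt, and_true]
  rw [and_comm]
  refine and_congr_left fun h0 => forall₃_congr fun i j hij => and_congr ?_ ?_
  · exact (ZMod.val_injective q).ne_iff
  · rw [Ne, Ne, eq_add_one_iff_val (h0 i)]

theorem natCard_avoids_ne_zero {n m : ℕ} (hm : m ≠ 0) :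
    Nat.card {x : Fin n → ZMod (n + m) // Avoids x ∧ ∀ i, x i ≠ 0} = m ^ n := by
  have : NeZero (n + m) := ⟨by lia⟩
  rw [← natCard_isPlacement (n := n) hm]
  refine Nat.card_eq_of_bijective
    (fun x => ⟨fun i => (x.1 i).val, isPlacement_val_iff.2 x.2⟩) ⟨fun x x' h => ?_, ?_⟩
  · refine Subtype.ext (funext fun i => ZMod.val_injective _ ?_)
    exact congrFun (Subtype.ext_iff.1 h) i
  · rintro ⟨y, hy⟩
    have h : (fun i => ((y i : ZMod (n + m))).val) = y :=
      funext fun i => ZMod.val_cast_of_lt (hy.1 i).2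
    exact ⟨⟨fun i => y i, isPlacement_val_iff.1 (by rwa [h])⟩, Subtype.ext h⟩

open Classical in
theorem card_avoids_mul {n m : ℕ} (hm : m ≠ 0) [NeZero (n + m)] :
    #{x : Fin n → ZMod (n + m) | Avoids x} * m = (n + m) * m ^ n := by
  have h := sum_card_bipartiteAbove_eq_sum_card_bipartiteBelow
    (s := ({x : Fin n → ZMod (n + m) | Avoids x} : Finset _))
    (t := (univ : Finset (ZMod (n + m)))) fun x c => ∀ i, x i ≠ c
  rw [sum_const_nat (m := m), sum_const_nat (m := m ^ n), card_univ, ZMod.card] at h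
  · exact h
  · intro c _
    rw [← natCard_avoids_ne_zero hm, bipartiteBelow, filter_filter,
      Nat.subtype_card ({x | Avoids x ∧ ∀ i, x i ≠ 0} : Finset (Fin n → ZMod (n + m))) (by simp)]
    -- Rotation moves the empty box `c` to `0`.
    exact card_bij' (fun x _ i => x i - c) (fun x _ i => x i + c)
      (fun x hx => by
        rw [mem_filter] at hx ⊢
        simpa [Avoids, sub_eq_zero, sub_add_eq_add_sub] using hx)
      (fun x hx => by
        rw [mem_filter] at hx ⊢
        simpa [Avoids, add_right_comm _ c] using hx)
      (by simp) (by simp)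
  · intro x hx
    have hx : Avoids x := by simpa using hx
    have e : (univ : Finset (ZMod (n + m))).bipartiteAbove (fun x c => ∀ i, x i ≠ c) x
        = univ \ univ.image x := by
      ext c
      simp [bipartiteAbove]
    rw [e, card_sdiff_of_subset (subset_univ _), card_image_of_injective _ hx.injective, card_univ,
      card_univ, ZMod.card, Fintype.card_fin]
    lia

/-! ### Möbius inversion for an arrangement -/

theorem mem_hyperplane {n : ℕ} {c : Fin n → ℝ} {b : ℝ} {x : Fin n → ℝ} :
    x ∈ hyperplane c b ↔ ∑ i, c i * x i = b := Iff.rfl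

theorem hyperplane_ne_top {n : ℕ} {c : Fin n → ℝ} (hc : c ≠ 0) (b : ℝ) : hyperplane c b ≠ ⊤ := by
  intro h
  have hm (x : Fin n → ℝ) : ∑ i, c i * x i = b := by
    rw [← mem_hyperplane, h]
    exact AffineSubspace.mem_top ℝ _ x
  have h0 : b = 0 := by simpa using (hm 0).symm
  refine hc (funext fun i => ?_)
  simpa [h0, Pi.single_apply] using hm (Pi.single i 1)

namespace Arrangement

variable {n : ℕ} (𝒜 : Arrangement n)

/-- The smallest element of the intersection poset (largest in its order) that contains `p`. -/
def flat (p : Fin n → ℝ) : 𝒜.IntersectionPoset :=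
  OrderDual.toDual ⟨sInf {H ∈ 𝒜.hyperplanes | p ∈ H}, by
    have hp : p ∈ sInf {H ∈ 𝒜.hyperplanes | p ∈ H} := by
      simp only [AffineSubspace.mem_sInf_iff]
      exact fun H hH => hH.2
    refine ⟨fun h => ?_, _, fun H hH => hH.1, rfl⟩
    rw [h] at hp
    exact AffineSubspace.notMem_bot ℝ _ p hp⟩

theorem le_flat_iff (E : 𝒜.IntersectionPoset) (p : Fin n → ℝ) :
    E ≤ 𝒜.flat p ↔ p ∈ (OrderDual.ofDual E).1 := by
  obtain ⟨E, hE⟩ := E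
  obtain ⟨-, ℬ, hℬ, rfl⟩ := hE
  change sInf {H ∈ 𝒜.hyperplanes | p ∈ H} ≤ sInf ℬ ↔ p ∈ sInf ℬ
  constructor
  · intro h
    refine h ?_
    simp only [AffineSubspace.mem_sInf_iff]
    exact fun H hH => hH.2
  · intro h
    rw [AffineSubspace.mem_sInf_iff] at h
    exact sInf_le_sInf fun H hH => ⟨hℬ hH, h H hH⟩

theorem zeroHat_le (E : 𝒜.IntersectionPoset) : 𝒜.zeroHat ≤ E :=
  show (OrderDual.ofDual E).1 ≤ ⊤ from le_top

theorem flat_eq_zeroHat_iff (p : Fin n → ℝ) :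
    𝒜.zeroHat = 𝒜.flat p ↔ ∀ H ∈ 𝒜.hyperplanes, p ∉ H := by
  constructor
  · intro h H hH hp
    have h1 : sInf {H ∈ 𝒜.hyperplanes | p ∈ H} = ⊤ := (Subtype.ext_iff.1 h).symm
    obtain ⟨c, b, hc, rfl⟩ := 𝒜.isHyperplane H hH
    refine hyperplane_ne_top hc b (top_le_iff.1 ?_)
    rw [← h1]
    exact sInf_le ⟨hH, hp⟩
  · intro h
    refine le_antisymm (𝒜.zeroHat_le _) ?_
    change ⊤ ≤ sInf {H ∈ 𝒜.hyperplanes | p ∈ H}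
    exact le_sInf fun H hH => absurd hH.2 (h H hH.1)

open Classical in
/-- The characteristic polynomial counts the points outside of all the hyperplanes, for any finite
family of points of which `q ^ dim E` lie in each intersection `E`. -/
theorem eval_charPoly {P : Type*} [Fintype P] (pt : P → Fin n → ℝ) (q : ℕ)
    (h : ∀ E ∈ 𝒜.intersections, #{x | pt x ∈ E} = q ^ Module.finrank ℝ E.direction) :
    𝒜.charPoly.eval (q : ℤ) = #{x | ∀ H ∈ 𝒜.hyperplanes, pt x ∉ H} := by
  have hr (E : 𝒜.IntersectionPoset) :
      n - 𝒜.rank E = Module.finrank ℝ (OrderDual.ofDual E).1.direction := by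
    have h1 := Submodule.finrank_le (OrderDual.ofDual E).1.direction
    rw [Module.finrank_fin_fun] at h1
    exact Nat.sub_sub_self h1
  have hE (E : 𝒜.IntersectionPoset) : (q : ℤ) ^ (n - 𝒜.rank E)
      = ∑ x : P, if E ≤ 𝒜.flat (pt x) then 1 else 0 := by
    rw [hr]
    have h1 := h _ (OrderDual.ofDual E).2
    simp only [le_flat_iff, sum_boole]
    exact_mod_cast h1.symm
  simp only [charPoly, Polynomial.eval_finsetSum, Polynomial.eval_mul, Polynomial.eval_C,
    Polynomial.eval_pow, Polynomial.eval_X, hE, mul_sum]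
  rw [sum_comm, natCast_card_filter]
  refine sum_congr rfl fun x _ => ?_
  simp only [← flat_eq_zeroHat_iff]
  -- The elements `E ≤ flat p` form the interval from `zeroHat` to `flat p`, over which `μ` sums to
  -- `1` or `0` according to whether `p` avoids all hyperplanes.
  rw [← IncidenceAlgebra.sum_Icc_mu_right (𝕜 := ℤ)]
  simp only [mul_ite, mul_one, mul_zero]
  rw [← sum_filter]
  refine sum_congr ?_ fun _ _ => rfl
  ext E
  simp [zeroHat_le]

end Arrangement

/-! ### The Shi arrangement modulo `q` -/

/-- The functions that take equal values at related points. -/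
def invariantFunctions (R : Type*) [Semiring R] {ι : Type*} (r : ι → ι → Prop) :
    Submodule R (ι → R) where
  carrier := {v | ∀ i j, r i j → v i = v j}
  add_mem' := fun hv hw i j h => congrArg₂ (· + ·) (hv i j h) (hw i j h)
  zero_mem' := fun _ _ _ => rfl
  smul_mem' := fun c _ hv i j h => congrArg (c * ·) (hv i j h)

/-- A function that takes equal values at related points is a function on the quotient. -/
def invariantFunctionsEquiv (R : Type*) [Semiring R] {ι : Type*} (r : ι → ι → Prop) :
    invariantFunctions R r ≃ₗ[R] (Quot r → R) where
  toFun v := Quot.lift v.1 v.2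
  invFun w := ⟨fun i => w (Quot.mk r i), fun _ _ h => congrArg w (Quot.sound h)⟩
  map_add' v w := funext fun i => by
    induction i using Quot.ind
    rfl
  map_smul' c v := funext fun i => by
    induction i using Quot.ind
    rfl
  left_inv _ := rfl
  right_inv w := funext fun i => by
    induction i using Quot.ind
    rfl

theorem finrank_invariantFunctions {ι : Type*} [Finite ι] (r : ι → ι → Prop) :
    Module.finrank ℝ (invariantFunctions ℝ r) = Nat.card (Quot r) := by
  have := Fintype.ofFinite (Quot r)
  rw [(invariantFunctionsEquiv ℝ r).finrank_eq, Module.finrank_pi, Nat.card_eq_fintype_card]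

theorem natCard_invariantFunctions {ι : Type*} [Finite ι] (r : ι → ι → Prop) (q : ℕ) :
    Nat.card (invariantFunctions (ZMod q) r) = q ^ Nat.card (Quot r) := by
  rw [Nat.card_congr (invariantFunctionsEquiv (ZMod q) r).toEquiv, Nat.card_fun, Nat.card_zmod]

theorem mem_hyperplane_single_sub_single {n : ℕ} {i j : Fin n} {a : ℝ} {x : Fin n → ℝ} :
    x ∈ hyperplane (Pi.single i 1 - Pi.single j 1) a ↔ x i - x j = a := by
  simp [mem_hyperplane, sub_mul, Pi.single_apply, sum_sub_distrib]

theorem exists_equations_of_mem_intersections {n : ℕ} {E : AffineSubspace ℝ (Fin n → ℝ)}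
    (hE : E ∈ (shi n).intersections) :
    ∃ D : Fin n → Fin n → ℤ → Prop, (∀ i j a, D i j a → a = 0 ∨ a = 1) ∧
      ∀ p, p ∈ E ↔ ∀ i j a, D i j a → p i - p j = a := by
  obtain ⟨-, ℬ, hℬ, rfl⟩ := hE
  refine ⟨fun i j a => (a = 0 ∨ a = 1) ∧
    hyperplane (Pi.single i 1 - Pi.single j 1) (a : ℝ) ∈ ℬ, fun i j a h => h.1, fun p => ?_⟩
  rw [AffineSubspace.mem_sInf_iff]
  constructor
  · rintro h i j a ⟨-, ha⟩
    exact mem_hyperplane_single_sub_single.1 (h _ ha)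
  · intro h H hH
    obtain ⟨i, j, -, a, ha | ha, rfl⟩ := hℬ hH
    · subst ha
      exact mem_hyperplane_single_sub_single.2 (by simpa using h i j 0 ⟨Or.inl rfl, by simpa⟩)
    · subst ha
      exact mem_hyperplane_single_sub_single.2 (by simpa using h i j 1 ⟨Or.inr rfl, by simpa⟩)

/-- Since `n < q`, some residue `c` is missed. Cutting the cycle there and taking representatives of
`x i - c` avoids wrap-around, so real points can stand in for points modulo `q`, with `q` not
necessarily prime. -/
theorem exists_lift {n q : ℕ} [NeZero q] (h : n < q) (x : Fin n → ZMod q) :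
    ∃ y : Fin n → ℤ, ∀ i j, ∀ a : ℤ, a = 0 ∨ a = 1 → (y i - y j = a ↔ x i - x j = a) := by
  obtain ⟨c, hc⟩ : ∃ c, ∀ i, x i ≠ c := by
    by_contra! hc
    have := Fintype.card_le_of_surjective x hc
    rw [ZMod.card, Fintype.card_fin] at this
    lia
  refine ⟨fun i => ((x i - c).val : ℤ), fun i j a ha => ?_⟩
  rcases ha with rfl | rfl
  · rw [sub_eq_zero, Nat.cast_inj, (ZMod.val_injective q).eq_iff, Int.cast_zero, sub_eq_zero,
      sub_left_inj]
  · have h1 := eq_add_one_iff_val (b := x j - c) (sub_ne_zero.2 (hc i))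
    have h2 : x i - c = x j - c + 1 ↔ x i - x j = 1 := by
      rw [sub_add_eq_add_sub, sub_left_inj, sub_eq_iff_eq_add']
    rw [Int.cast_one, ← h2, h1]
    lia

/-- The floors of a point of `E` solve the integral equations, so over `ℝ` and over `ℤ/q` alike the
solutions are a translate of the functions constant on the classes of related indices. -/
theorem card_equations {n q : ℕ} [NeZero q] {E : AffineSubspace ℝ (Fin n → ℝ)}
    {D : Fin n → Fin n → ℤ → Prop} (hD : ∀ p, p ∈ E ↔ ∀ i j a, D i j a → p i - p j = a)
    (hE : E ≠ ⊥) :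
    Nat.card {x : Fin n → ZMod q // ∀ i j a, D i j a → x i - x j = a}
      = q ^ Module.finrank ℝ E.direction := by
  obtain ⟨p, hp⟩ := (AffineSubspace.nonempty_iff_ne_bot E).2 hE
  have hpE : p ∈ E := hp
  replace hp := (hD p).1 hpE
  have hz (i j : Fin n) (a : ℤ) (h : D i j a) : ⌊p i⌋ - ⌊p j⌋ = a := by
    rw [show p i = p j + a by linarith [hp i j a h], Int.floor_add_intCast]
    ring
  set r : Fin n → Fin n → Prop := fun i j => ∃ a, D i j a
  have hdir : E.direction = invariantFunctions ℝ r := by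
    ext v
    rw [← AffineSubspace.vadd_mem_iff_mem_direction v hpE, hD]
    constructor
    · rintro h i j ⟨a, ha⟩
      have h1 : v i + p i - (v j + p j) = a := h i j a ha
      linarith [hp i j a ha]
    · intro h i j a ha
      change v i + p i - (v j + p j) = a
      have h1 : v i = v j := h i j ⟨a, ha⟩
      linarith [hp i j a ha]
  rw [hdir, finrank_invariantFunctions, ← natCard_invariantFunctions]
  refine Nat.card_congr ((Equiv.subRight fun i => ((⌊p i⌋ : ℤ) : ZMod q)).subtypeEquiv fun x => ?_)
  have hz' (i j : Fin n) (a : ℤ) (h : D i j a) : ((⌊p i⌋ : ℤ) : ZMod q) - (⌊p j⌋ : ℤ) = a := by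
    rw [← hz i j a h, Int.cast_sub]
  constructor
  · rintro h i j ⟨a, ha⟩
    change x i - _ = x j - _
    linear_combination h i j a ha - hz' i j a ha
  · intro h i j a ha
    have h1 : x i - ((⌊p i⌋ : ℤ) : ZMod q) = x j - ((⌊p j⌋ : ℤ) : ZMod q) := h i j ⟨a, ha⟩
    linear_combination h1 + hz' i j a ha

open Classical in
theorem eval_charPoly_shi {n q : ℕ} [NeZero q] (h : n < q) :
    (shi n).charPoly.eval (q : ℤ) = #{x : Fin n → ZMod q | Avoids x} := by
  choose y hy using exists_lift (n := n) h
  rw [(shi n).eval_charPoly (fun x i => (y x i : ℝ)) q]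
  · congr 2
    ext x
    have key (i j : Fin n) (a : ℤ) (ha : a = 0 ∨ a = 1) :
        (y x i : ℝ) - y x j = a ↔ x i - x j = a := by
      rw [← hy x i j a ha]
      exact_mod_cast Iff.rfl
    have k0 (i j : Fin n) : (y x i : ℝ) - y x j = 0 ↔ x i = x j := by
      simpa [sub_eq_zero] using key i j 0 (Or.inl rfl)
    have k1 (i j : Fin n) : (y x i : ℝ) - y x j = 1 ↔ x i = x j + 1 := by
      simpa [sub_eq_iff_eq_add'] using key i j 1 (Or.inr rfl)
    simp only [mem_filter, mem_univ, true_and]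
    constructor
    · intro hx i j hij
      refine ⟨fun h => hx _ ⟨i, j, hij, 0, Or.inl rfl, rfl⟩ ?_,
        fun h => hx _ ⟨i, j, hij, 1, Or.inr rfl, rfl⟩ ?_⟩
      · exact mem_hyperplane_single_sub_single.2 ((k0 i j).2 h)
      · exact mem_hyperplane_single_sub_single.2 ((k1 i j).2 h)
    · rintro hx _ ⟨i, j, hij, a, rfl | rfl, rfl⟩ hm
      · exact (hx i j hij).1 ((k0 i j).1 (mem_hyperplane_single_sub_single.1 hm))
      · exact (hx i j hij).2 ((k1 i j).1 (mem_hyperplane_single_sub_single.1 hm))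
  · intro E hE
    obtain ⟨D, hD1, hD2⟩ := exists_equations_of_mem_intersections hE
    rw [← card_equations hD2 hE.1, Nat.subtype_card]
    intro x
    simp only [mem_filter, mem_univ, true_and, hD2]
    refine forall₄_congr fun i j a ha => ?_
    rw [← hy x i j a (hD1 i j a ha)]
    exact_mod_cast Iff.rfl

theorem charPoly_shi_mul (n : ℕ) :
    (shi n).charPoly * (Polynomial.X - Polynomial.C (n : ℤ))
      = Polynomial.X * (Polynomial.X - Polynomial.C (n : ℤ)) ^ n := by
  classical
  refine Polynomial.eq_of_infinite_eval_eq _ _ ((Set.infinite_range_of_injective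
    (f := fun m : ℕ => ((n + (m + 1) : ℕ) : ℤ)) fun a b h => by simpa using h).mono ?_)
  rintro _ ⟨m, rfl⟩
  have : NeZero (n + (m + 1)) := ⟨by lia⟩
  have h := card_avoids_mul (n := n) (Nat.succ_ne_zero m)
  have h1 := eval_charPoly_shi (n := n) (q := n + (m + 1)) (by lia)
  have e : ((n + (m + 1) : ℕ) : ℤ) - n = ((m + 1 : ℕ) : ℤ) := by push_cast; ring
  simp only [Set.mem_ofPred_eq, Polynomial.eval_mul, Polynomial.eval_sub, Polynomial.eval_X,
    Polynomial.eval_C, Polynomial.eval_pow, h1, e]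
  exact_mod_cast h

theorem charPoly_shi {n : ℕ} (hn : n ≠ 0) :
    (shi n).charPoly = Polynomial.X * (Polynomial.X - Polynomial.C (n : ℤ)) ^ (n - 1) := by
  obtain ⟨k, rfl⟩ := Nat.exists_eq_succ_of_ne_zero hn
  have h := charPoly_shi_mul (k + 1)
  rw [pow_succ, ← mul_assoc] at h
  exact mul_right_cancel₀ (Polynomial.X_sub_C_ne_zero _) h

theorem charPoly_shi_zero : (shi 0).charPoly = 1 := by
  have h := charPoly_shi_mul 0
  simp only [Nat.cast_zero, map_zero, sub_zero, pow_zero, mul_one] at h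
  exact mul_right_cancel₀ Polynomial.X_ne_zero (h.trans (one_mul _).symm)

end ShiArr

theorem mainTheorem4 :
    (∃ F : PowerSeries ℚ,
      ShiArr.IsFormalLimit (fun r : ℕ => ShiArr.A (r + 1) * (ShiArr.A r)⁻¹) F ∧
      PowerSeries.constantCoeff F = 1 ∧
      ShiArr.shiEGF =
        ShiArr.cpow (PowerSeries.map (Polynomial.C : ℚ →+* Polynomial ℚ) F) Polynomial.X) ∧
    ShiArr.IsFormalLimit (fun r : ℕ => ShiArr.A r * (ShiArr.A (r + 1))⁻¹)
      (PowerSeries.mk fun n : ℕ =>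
        (-1 : ℚ) ^ n * ((n : ℚ) + 1) ^ ((n : ℤ) - 1) / (n.factorial : ℚ)) := by
  refine ⟨⟨ShiArr.abelPowSeries 1, ShiArr.isFormalLimit_A_div,
    ShiArr.constantCoeff_abelPowSeries 1,
    ShiArr.shiEGF_eq_cpow (fun n hn => ShiArr.charPoly_shi hn) ShiArr.charPoly_shi_zero⟩, ?_⟩
  rw [← ShiArr.abelPowSeries_neg_one]
  exact ShiArr.isFormalLimit_A_div_succ
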